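/- Let $G=(V,E)$ be a finite simple graph. Given peaks $b\in\mathbb R_{\ge 0}^V$, a *feasible exchange* is a family $f_{ij}\ge 0$ $(i,j\in V)$ with $f_{ij}=f_{ji}$, with $f_{ij}=0$ if $ij\notin E$, and with $x_i(f):=\sum_j f_{ij}\le b_i$ for all $i$; then $x(f)\in\mathbb R^V$ is called a *feasible allocation*. Let $G_b$ be the bipartite network with two copies $A=V$ and $B=V$ of the agents (both with peaks $b$), and with an edge from $i\in A$ to $j\in B$ if and only if $ij\in E$. A *feasible flow* $(y,g,w)$ on $G_b$ consists of $g_{ij}\ge 0$ $(i\in A,\ j\in B)$, zero off the edges, with $y_i=\sum_j g_{ij}\le b_i$ for $i\in A$ and $w_j=\sum_i g_{ij}\le b_j$ for $j\in B$. *Egalitarian rule of Bochet et al. (BIMS).* For a bipartite network with suppliers $S$, demanders $D$ and peaks $s_i,d_j\ge 0$, the egalitarian shares of the suppliers are defined recursively. For $X\subseteq S$ let $N(X)\subseteq D$ be the set of demanders linked to $X$. Let $\lambda^*$ be the least $\lambda\ge 0$ for which some nonempty $X\subseteq S$ satisfies $\sum_{i\in X}\min(\lambda,s_i)=\sum_{j\in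 N(X)}d_j$. If there is no such $\lambda$, every supplier receives $s_i$. Otherwise let $X^*$ be the largest such $X$ for $\lambda=\lambda^*$; each $i\in X^*$ receives $\min(\lambda^*,s_i)$, and the shares of the other suppliers are those of the network with suppliers $S\setminus X^*$ and demanders $D\setminus N(X^*)$. The egalitarian shares of the demanders are defined in the same way with the two sides exchanged. Let $(x^e,y^e)$ be the egalitarian shares of $G_b$ and put $\varphi_i(b)=(x^e_i+y^e_i)/2$ for $i\in V$. A preference on $\mathbb R_{\ge0}$ (complete, transitive, with strict part $P$) is *single-peaked* with peak $p$ if $x'<x\le p$ or $p\le x<x'$ implies $x\,P\,x'$. **Lemma.** For all $b\in\mathbb R_{\ge0}^V$: 1. If $(y,g,w)$ is a feasible flow on $G_b$, then $f_{ij}=(g_{ij}+g_{ji})/2$ is a feasible exchange on $G$, with $x_i(f)=(y_i+w_i)/2$. Conversely, if $f$ is a feasible exchange on $G$, then $g=f$, $y=w=x(f)$ is a feasible flow on $G_b$. 2. There is a feasible flow on $G_b$ with $y=x^e$ and $w=y^e$, and each such flow gives, as in 1, a feasible exchange on $G$ that induces the allocation $\varphi(b)$. 3. For every profile $R=(R_i)_{i\in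 V}$ of single-peaked preferences with peaks $b$, the allocation $x=\varphi(b)$ is - Pareto optimal: $x$ is feasible, and no feasible allocation is weakly better for all agents and strictly better for one; - Lorenz dominant in the set of Pareto optimal allocations: for each Pareto optimal $z$ and $1\le k\le |V|$, the sum of the $k$ smallest coordinates of $x$ is at least that of $z$; - envy-free: if $x_j\,P_i\,x_i$, then there is no feasible allocation $x'$ with $x'_k=x_k$ for all $k\ne i,j$ and $x'_i\,P_i\,x_i$. Moreover, the rule $\varphi$ is peak strategyproof: for all $b\in\mathbb R_{\ge0}^V$, all $i\in V$, every single-peaked preference $R_i$ with peak $b_i$ and every report $p\ge 0$ one has $\varphi_i(b)\,R_i\,\varphi_i(p,b_{-i})$. -/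

import Mathlib

/-- A finite bipartite network with suppliers `A`, demanders `B`, a set of (uncapacitated) edges,
and the peaks (capacities) `supply i` and `demand j` of its nodes. -/
structure BipartiteNetwork (A B : Type*) where
  edge : A → B → Prop
  supply : A → ℝ
  demand : B → ℝ

/-- A shipment from a source to a sink through the two sides of a bipartite network:
`src i` is the flow from the source to `i ∈ A`, `mid i j` the flow from `i ∈ A` to `j ∈ B`,
and `snk j` the flow from `j ∈ B` to the sink. -/
structure BipartiteFlow (A B : Type*) where
  src : A → ℝ
  mid : A → B → ℝ
  snk : B → ℝ

namespace BipartiteNetwork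

/-- Feasible flows: nonnegative, supported on the edges, conserved at every node of `A` and `B`,
and no larger than the peak of each node. -/
structure IsFeasibleFlow {A B : Type*} [Fintype A] [Fintype B] (N : BipartiteNetwork A B)
    (φ : BipartiteFlow A B) : Prop where
  nonneg : ∀ i j, 0 ≤ φ.mid i j
  support : ∀ i j, ¬ N.edge i j → φ.mid i j = 0
  conservation_left : ∀ i, φ.src i = ∑ j, φ.mid i j
  conservation_right : ∀ j, ∑ i, φ.mid i j = φ.snk j
  supply_le : ∀ i, φ.src i ≤ N.supply i
  demand_le : ∀ j, φ.snk j ≤ N.demand j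

/-- The same network with the roles of suppliers and demanders exchanged. -/
def reverse {A B : Type*} (N : BipartiteNetwork A B) : BipartiteNetwork B A where
  edge j i := N.edge i j
  supply := N.demand
  demand := N.supply

open Classical in
/-- The demanders in `D` that are linked to some supplier in `X`. -/
noncomputable def neighbors {A B : Type*} (N : BipartiteNetwork A B) (D : Finset B)
    (X : Finset A) : Finset B :=
  D.filter fun j => ∃ i ∈ X, N.edge i j

/-- In the subnetwork with suppliers `S` and demanders `D`, the nonempty set `X` of suppliers is
a bottleneck at level `t`: if each supplier `i` sends `min t (supply i)`, then the suppliers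
in `X` exactly exhaust the demand of their neighbors. -/
def IsBottleneck {A B : Type*} (N : BipartiteNetwork A B) (S : Finset A) (D : Finset B)
    (t : ℝ) (X : Finset A) : Prop :=
  X ⊆ S ∧ X.Nonempty ∧ ∑ i ∈ X, min t (N.supply i) = ∑ j ∈ N.neighbors D X, N.demand j

/-- `t` is the first level `t ≥ 0` at which there is a bottleneck. -/
def IsFirstBreakpoint {A B : Type*} (N : BipartiteNetwork A B) (S : Finset A) (D : Finset B)
    (t : ℝ) : Prop :=
  IsLeast {r : ℝ | 0 ≤ r ∧ ∃ X, N.IsBottleneck S D r X} t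

open Classical in
/-- The union of all bottleneck sets at level `t`. At the first breakpoint the bottleneck sets
are closed under union, so that this is the largest one. -/
noncomputable def largestBottleneck {A B : Type*} (N : BipartiteNetwork A B) (S : Finset A)
    (D : Finset B) (t : ℝ) : Finset A :=
  S.filter fun i => ∃ X, N.IsBottleneck S D t X ∧ i ∈ X

open Classical in
theorem IsFirstBreakpoint.nonempty {A B : Type*} {N : BipartiteNetwork A B} {S : Finset A}
    {D : Finset B} {t : ℝ} (h : N.IsFirstBreakpoint S D t) :
    (N.largestBottleneck S D t).Nonempty := by
  obtain ⟨-, X, hX⟩ := h.1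
  obtain ⟨i, hi⟩ := hX.2.1
  exact ⟨i, Finset.mem_filter.2 ⟨hX.1 hi, X, hX, hi⟩⟩

open Classical in
theorem largestBottleneck_subset {A B : Type*} (N : BipartiteNetwork A B) (S : Finset A)
    (D : Finset B) (t : ℝ) : N.largestBottleneck S D t ⊆ S :=
  Finset.filter_subset _ _

open Classical in
/-- The egalitarian shares of the suppliers in the subnetwork with suppliers `S` and
demanders `D`. If there is no bottleneck at any level, every supplier gets his peak. Otherwise let
`t` be the first breakpoint and `X` the largest bottleneck set at level `t`: every `i ∈ X` gets
`min t (supply i)`, and the other suppliers get their shares in the problem that is left after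
the removal of `X` and of its neighbors. -/
noncomputable def egalitarianShare {A B : Type*} (N : BipartiteNetwork A B) (S : Finset A)
    (D : Finset B) : A → ℝ :=
  if h : ∃ t, N.IsFirstBreakpoint S D t then
    fun i =>
      if i ∈ N.largestBottleneck S D h.choose then min h.choose (N.supply i)
      else N.egalitarianShare (S \ N.largestBottleneck S D h.choose)
        (D \ N.neighbors D (N.largestBottleneck S D h.choose)) i
  else N.supply
termination_by S.card
decreasing_by
  exact Finset.card_lt_card (Finset.sdiff_ssubset (N.largestBottleneck_subset S D _)
    h.choose_spec.nonempty)

/-- The suppliers' part of the egalitarian allocation. -/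
noncomputable def egalitarianSupply {A B : Type*} [Fintype A] [Fintype B]
    (N : BipartiteNetwork A B) : A → ℝ :=
  N.egalitarianShare Finset.univ Finset.univ

/-- The demanders' part of the egalitarian allocation: the same construction with the roles of
suppliers and demanders exchanged. -/
noncomputable def egalitarianDemand {A B : Type*} [Fintype A] [Fintype B]
    (N : BipartiteNetwork A B) : B → ℝ :=
  N.reverse.egalitarianShare Finset.univ Finset.univ

end BipartiteNetwork

namespace Exchange

/-- The doubled network: two copies `A = V` and `B = V` of the agents with their peaks, and an edge
from `i ∈ A` to `j ∈ B` for every edge `ij` of `G`. -/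
def doubled {V : Type*} (G : SimpleGraph V) (b : V → ℝ) : BipartiteNetwork V V where
  edge i j := G.Adj i j
  supply := b
  demand := b

/-- The allocation induced by the amounts `f i j` exchanged between `i` and `j`. -/
def allocation {V : Type*} [Fintype V] (f : V → V → ℝ) : V → ℝ :=
  fun i => ∑ j, f i j

/-- Feasible (divisible) exchanges on `G`: nonnegative amounts on the edges of `G`, with
`f i j = f j i`, such that no agent exchanges more than his peak. -/
structure IsFeasibleExchange {V : Type*} [Fintype V] (G : SimpleGraph V) (b : V → ℝ)
    (f : V → V → ℝ) : Prop where
  nonneg : ∀ i j, 0 ≤ f i j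
  support : ∀ i j, ¬ G.Adj i j → f i j = 0
  symm : ∀ i j, f i j = f j i
  le_peak : ∀ i, allocation f i ≤ b i

/-- Feasible allocations: those induced by a feasible exchange. -/
def IsFeasibleAllocation {V : Type*} [Fintype V] (G : SimpleGraph V) (b : V → ℝ)
    (x : V → ℝ) : Prop :=
  ∃ f, IsFeasibleExchange G b f ∧ allocation f = x

/-- The exchange on `G` obtained from a flow on the doubled network by averaging. -/
noncomputable def symmetrize {V : Type*} (φ : BipartiteFlow V V) : V → V → ℝ :=
  fun i j => (φ.mid i j + φ.mid j i) / 2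

/-- The flow on the doubled network that sends `f i j` from `i ∈ A` to `j ∈ B`. -/
def toFlow {V : Type*} [Fintype V] (f : V → V → ℝ) : BipartiteFlow V V where
  src := allocation f
  mid := f
  snk := allocation f

/-- The egalitarian rule of the doubled network as a rule for `G`: it maps the (reported) peaks to
the average of the egalitarian shares of the two copies of each agent. -/
noncomputable def egalitarianRule {V : Type*} [Fintype V] (G : SimpleGraph V) (b : V → ℝ) :
    V → ℝ :=
  fun i => ((doubled G b).egalitarianSupply i + (doubled G b).egalitarianDemand i) / 2

/-- `R x y` (amount `x` is at least as good as `y`) is a complete and transitive preference on the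
amounts `x ≥ 0` that is single-peaked with peak `p`. -/
structure IsSinglePeaked (R : ℝ → ℝ → Prop) (p : ℝ) : Prop where
  total : ∀ x y, 0 ≤ x → 0 ≤ y → R x y ∨ R y x
  trans : ∀ x y z, 0 ≤ x → 0 ≤ y → 0 ≤ z → R x y → R y z → R x z
  below : ∀ x x', 0 ≤ x' → x' < x → x ≤ p → R x x' ∧ ¬ R x' x
  above : ∀ x x', 0 ≤ x → p ≤ x → x < x' → R x x' ∧ ¬ R x' x

/-- No feasible allocation is weakly better for all agents and strictly better for one. -/
def IsParetoOptimal {V : Type*} [Fintype V] (G : SimpleGraph V) (b : V → ℝ)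
    (R : V → ℝ → ℝ → Prop) (x : V → ℝ) : Prop :=
  IsFeasibleAllocation G b x ∧
    ∀ x', IsFeasibleAllocation G b x' → (∀ i, R i (x' i) (x i)) →
      ∀ i, R i (x' i) (x i) ∧ R i (x i) (x' i)

/-- The sum of the `k` smallest coordinates of `z` (the first `k` order statistics). -/
noncomputable def lowestSum {V : Type*} [Fintype V] (z : V → ℝ) (k : ℕ) : ℝ :=
  (((Finset.univ.val.map z).sort (· ≤ ·)).take k).sum

/-- `z` Lorenz dominates `w`. -/
def LorenzDominates {V : Type*} [Fintype V] (z w : V → ℝ) : Prop :=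
  ∀ k, 1 ≤ k → k ≤ Fintype.card V → lowestSum w k ≤ lowestSum z k

/-- `x` is Lorenz dominant inside the Pareto optimal set. -/
def IsLorenzDominant {V : Type*} [Fintype V] (G : SimpleGraph V) (b : V → ℝ)
    (R : V → ℝ → ℝ → Prop) (x : V → ℝ) : Prop :=
  IsParetoOptimal G b R x ∧ ∀ w, IsParetoOptimal G b R w → LorenzDominates x w

/-- No envy: if `i` strictly prefers the amount of `j` to his own, then there is no feasible
allocation that `i` strictly prefers and that changes the amounts of `i` and `j` only. -/
def IsEnvyFree {V : Type*} [Fintype V] (G : SimpleGraph V) (b : V → ℝ)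
    (R : V → ℝ → ℝ → Prop) (x : V → ℝ) : Prop :=
  ∀ i j, R i (x j) (x i) ∧ ¬ R i (x i) (x j) →
    ¬ ∃ x', IsFeasibleAllocation G b x' ∧ (∀ k, k ≠ i → k ≠ j → x' k = x k) ∧
      R i (x' i) (x i) ∧ ¬ R i (x i) (x' i)

/-- Peak strategyproofness of a rule that maps reported peaks to allocations: whatever the others
report, no agent prefers what he gets by reporting `p` to what he gets by reporting his
true peak `b i`. -/
def IsPeakStrategyproof {V : Type*} [DecidableEq V] (rule : (V → ℝ) → V → ℝ) : Prop :=
  ∀ b : V → ℝ, (∀ k, 0 ≤ b k) → ∀ (i : V) (Ri : ℝ → ℝ → Prop), IsSinglePeaked Ri (b i) →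
    ∀ p : ℝ, 0 ≤ p → Ri (rule b i) (rule (Function.update b i p) i)

end Exchange

/-! Everything rests on one certificate. Call a set `X` tight for `x` if `x(X) = b(N(X))`. The fair
point satisfies `0 ≤ x ≤ b` and `x(X) ≤ b(N(X))` for all `X`, and each agent below his peak lies in
a tight set in which nobody gets more than he does. The recursion produces such a point
(`isEgalitarian_egalitarianShare`), and it is unique (`IsEgalitarian.eq`). The doubled network is
its own reverse, so both copies of an agent get the same share and the rule equals this fair point
`x`.

Tight sets are closed under union by submodularity, so one tight set contains all agents below their
peaks. As feasible allocations obey the same inequalities, tight sets block every improvement: this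
gives Pareto optimality, absence of envy and, by maximality of `∑ min (x i) t` for every `t`, Lorenz
dominance. An agent below his peak is never a neighbor of a tight set, so the certificate survives a
change of his report; uniqueness then gives strategyproofness.

For feasibility `x` must be shipped from `x` to `x`, which needs the stronger Hall condition `x(X) ≤
x(N(X))` (`IsFair.sum_le_sum_neighbors`). The symmetry of the graph yields it, and `exists_shipment`
gives the flow. -/

namespace BipartiteNetwork

variable {A B : Type*} {N : BipartiteNetwork A B} {S : Finset A} {D : Finset B}

/-! ### Neighborhoods and tight sets -/

theorem mem_neighbors {X : Finset A} {j : B} :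
    j ∈ N.neighbors D X ↔ j ∈ D ∧ ∃ i ∈ X, N.edge i j := by
  simp [neighbors]

theorem neighbors_mono {X Y : Finset A} (h : X ⊆ Y) : N.neighbors D X ⊆ N.neighbors D Y := by
  intro j hj
  obtain ⟨hD, i, hi, he⟩ := mem_neighbors.1 hj
  exact mem_neighbors.2 ⟨hD, i, h hi, he⟩

theorem neighbors_empty : N.neighbors D ∅ = ∅ := by
  ext j
  simp [mem_neighbors]

open Classical in
theorem neighbors_union (X Y : Finset A) :
    N.neighbors D (X ∪ Y) = N.neighbors D X ∪ N.neighbors D Y := by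
  ext j
  simp only [mem_neighbors, Finset.mem_union]
  grind

open Classical in
/-- The demand that `X ∪ Y` reaches is the demand reached by `Y`, plus the demand
reached by `X` once the neighbors of `Y` are removed. -/
theorem sum_neighbors_union (X Y : Finset A) :
    ∑ j ∈ N.neighbors D (X ∪ Y), N.demand j =
      ∑ j ∈ N.neighbors (D \ N.neighbors D Y) X, N.demand j +
        ∑ j ∈ N.neighbors D Y, N.demand j := by
  rw [← Finset.sum_union]
  · congr 1
    ext j
    simp only [mem_neighbors, Finset.mem_union, Finset.mem_sdiff]
    grind
  · rw [Finset.disjoint_left]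
    intro j hj
    exact (Finset.mem_sdiff.1 (mem_neighbors.1 hj).1).2

open Classical in
/-- Submodularity: if `y` respects all the neighborhood constraints, then the sets for which the
constraint is tight are closed under union. -/
theorem tight_union (hd : ∀ j, 0 ≤ N.demand j) {y : A → ℝ}
    (hy : ∀ X ⊆ S, ∑ i ∈ X, y i ≤ ∑ j ∈ N.neighbors D X, N.demand j) {X Y : Finset A}
    (hXS : X ⊆ S) (hYS : Y ⊆ S) (hX : ∑ i ∈ X, y i = ∑ j ∈ N.neighbors D X, N.demand j)
    (hY : ∑ i ∈ Y, y i = ∑ j ∈ N.neighbors D Y, N.demand j) :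
    ∑ i ∈ X ∪ Y, y i = ∑ j ∈ N.neighbors D (X ∪ Y), N.demand j := by
  have h1 := hy _ (Finset.union_subset hXS hYS)
  have h2 := hy _ ((Finset.inter_subset_left (s₁ := X) (s₂ := Y)).trans hXS)
  have h3 := Finset.sum_union_inter (s₁ := X) (s₂ := Y) (f := y)
  have h4 := Finset.sum_union_inter (s₁ := N.neighbors D X) (s₂ := N.neighbors D Y)
    (f := N.demand)
  have h5 : ∑ j ∈ N.neighbors D (X ∩ Y), N.demand j ≤
      ∑ j ∈ N.neighbors D X ∩ N.neighbors D Y, N.demand j :=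
    Finset.sum_le_sum_of_subset_of_nonneg
      (Finset.subset_inter (neighbors_mono Finset.inter_subset_left)
        (neighbors_mono Finset.inter_subset_right)) fun j _ _ => hd j
  rw [neighbors_union] at h1 ⊢
  linarith

open Classical in
theorem tight_biUnion (hd : ∀ j, 0 ≤ N.demand j) {y : A → ℝ}
    (hy : ∀ X ⊆ S, ∑ i ∈ X, y i ≤ ∑ j ∈ N.neighbors D X, N.demand j)
    {ι : Type*} (I : Finset ι) (T : ι → Finset A) (hTS : ∀ k ∈ I, T k ⊆ S)
    (hT : ∀ k ∈ I, ∑ i ∈ T k, y i = ∑ j ∈ N.neighbors D (T k), N.demand j) :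
    ∑ i ∈ I.biUnion T, y i = ∑ j ∈ N.neighbors D (I.biUnion T), N.demand j := by
  induction I using Finset.induction_on with
  | empty => simp [neighbors_empty]
  | insert a I ha ih =>
    rw [Finset.biUnion_insert]
    simp only [Finset.mem_insert, forall_eq_or_imp] at hTS hT
    exact tight_union hd hy hTS.1 (Finset.biUnion_subset.2 hTS.2) hT.1 (ih hTS.2 hT.2)

/-! ### Breakpoints and bottlenecks -/

/-- Intermediate value theorem: at level `0` the suppliers in `X` send nothing, at level `t` they
send too much. Hence no constraint is violated at the first breakpoint. -/
theorem exists_bottleneck_le (hs : ∀ i, 0 ≤ N.supply i) (hd : ∀ j, 0 ≤ N.demand j) {t : ℝ}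
    (ht : 0 ≤ t) {X : Finset A} (hX : X ⊆ S)
    (h : ∑ j ∈ N.neighbors D X, N.demand j < ∑ i ∈ X, min t (N.supply i)) :
    ∃ r, 0 ≤ r ∧ r < t ∧ N.IsBottleneck S D r X := by
  have hc : ContinuousOn (fun r => ∑ i ∈ X, min r (N.supply i)) (Set.Icc 0 t) := by fun_prop
  have h0 : ∑ i ∈ X, min 0 (N.supply i) = 0 := by
    simp [hs]
  have hN : 0 ≤ ∑ j ∈ N.neighbors D X, N.demand j := Finset.sum_nonneg fun j _ => hd j
  obtain ⟨r, hr, hrX⟩ := intermediate_value_Icc ht hc ⟨h0.trans_le hN, h.le⟩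
  have hrX : ∑ i ∈ X, min r (N.supply i) = _ := hrX
  refine ⟨r, hr.1, lt_of_le_of_ne hr.2 ?_, hX, ?_, hrX⟩
  · rintro rfl
    exact h.ne' hrX
  · rw [Finset.nonempty_iff_ne_empty]
    rintro rfl
    simp [neighbors_empty] at h

theorem IsFirstBreakpoint.sum_le (hs : ∀ i, 0 ≤ N.supply i) (hd : ∀ j, 0 ≤ N.demand j) {t : ℝ}
    (h : N.IsFirstBreakpoint S D t) {X : Finset A} (hX : X ⊆ S) :
    ∑ i ∈ X, min t (N.supply i) ≤ ∑ j ∈ N.neighbors D X, N.demand j := by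
  by_contra! hlt
  obtain ⟨r, hr, hrt, hb⟩ := exists_bottleneck_le hs hd h.1.1 hX hlt
  exact hrt.not_ge (h.2 ⟨hr, X, hb⟩)

open Classical in
-- At the first breakpoint `min t (supply i)` respects every constraint, so the bottlenecks are
-- tight sets and their union is tight.
theorem IsFirstBreakpoint.sum_largestBottleneck (hs : ∀ i, 0 ≤ N.supply i)
    (hd : ∀ j, 0 ≤ N.demand j) {t : ℝ} (h : N.IsFirstBreakpoint S D t) :
    ∑ i ∈ N.largestBottleneck S D t, min t (N.supply i) =
      ∑ j ∈ N.neighbors D (N.largestBottleneck S D t), N.demand j := by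
  have he : N.largestBottleneck S D t =
      (S.powerset.filter fun X => N.IsBottleneck S D t X).biUnion id := by
    ext i
    simp only [largestBottleneck, Finset.mem_filter, Finset.mem_biUnion, Finset.mem_powerset, id]
    constructor
    · rintro ⟨-, X, hX, hi⟩
      exact ⟨X, ⟨hX.1, hX⟩, hi⟩
    · rintro ⟨X, ⟨hXS, hX⟩, hi⟩
      exact ⟨hXS hi, X, hX, hi⟩
  rw [he]
  refine tight_biUnion hd (fun X hX => h.sum_le hs hd hX) _ _ ?_ ?_
  · intro X hX
    exact Finset.mem_powerset.1 (Finset.mem_filter.1 hX).1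
  · intro X hX
    exact (Finset.mem_filter.1 hX).2.2.2

/-- The levels with a bottleneck form a finite union, over `X ⊆ S`, of closed sets, so their infimum
is attained. -/
theorem exists_isFirstBreakpoint {t : ℝ} (ht : 0 ≤ t) {X : Finset A}
    (h : N.IsBottleneck S D t X) : ∃ r, N.IsFirstBreakpoint S D r := by
  have hcl : IsClosed {r : ℝ | 0 ≤ r ∧ ∃ X, N.IsBottleneck S D r X} := by
    have he : {r : ℝ | 0 ≤ r ∧ ∃ X, N.IsBottleneck S D r X} =
        Set.Ici 0 ∩ ⋃ X ∈ {X : Finset A | X ⊆ S ∧ X.Nonempty},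
          {r : ℝ | ∑ i ∈ X, min r (N.supply i) = ∑ j ∈ N.neighbors D X, N.demand j} := by
      ext r
      simp [IsBottleneck, and_assoc]
    rw [he]
    refine isClosed_Ici.inter (Set.Finite.isClosed_biUnion ?_ fun X _ => ?_)
    · exact (Finset.finite_toSet S.powerset).subset fun X hX => by simpa using hX.1
    · exact isClosed_eq (by fun_prop) continuous_const
  exact ⟨_, hcl.isLeast_csInf ⟨t, ht, X, h⟩ ⟨0, fun r hr => hr.1⟩⟩

/-! ### The fair point: existence, uniqueness, majorization -/

/-- `x` is the fair point of the polymatroid of the shipments that the suppliers in `S` can make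
to the demanders in `D`: a supplier who sends less than his peak belongs to a set of suppliers
who exhaust all of their neighbors and send at most as much as he does. -/
structure IsEgalitarian (N : BipartiteNetwork A B) (S : Finset A) (D : Finset B)
    (x : A → ℝ) : Prop where
  nonneg : ∀ i ∈ S, 0 ≤ x i
  le_supply : ∀ i ∈ S, x i ≤ N.supply i
  sum_le : ∀ X ⊆ S, ∑ i ∈ X, x i ≤ ∑ j ∈ N.neighbors D X, N.demand j
  exists_tight : ∀ i ∈ S, x i < N.supply i → ∃ T ⊆ S, i ∈ T ∧
    ∑ k ∈ T, x k = ∑ j ∈ N.neighbors D T, N.demand j ∧ ∀ k ∈ T, x k ≤ x i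

theorem sum_supply_le (hs : ∀ i, 0 ≤ N.supply i) (hd : ∀ j, 0 ≤ N.demand j)
    (h : ¬ ∃ t, N.IsFirstBreakpoint S D t) {X : Finset A} (hX : X ⊆ S) :
    ∑ i ∈ X, N.supply i ≤ ∑ j ∈ N.neighbors D X, N.demand j := by
  by_contra! hlt
  -- The total supply of `X` is a level so high that it caps nobody in `X`.
  have hm : ∑ i ∈ X, min (∑ i ∈ X, N.supply i) (N.supply i) = ∑ i ∈ X, N.supply i :=
    Finset.sum_congr rfl fun i hi =>
      min_eq_right (Finset.single_le_sum (fun k _ => hs k) hi)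
  rw [← hm] at hlt
  obtain ⟨r, hr, -, hb⟩ :=
    exists_bottleneck_le hs hd (Finset.sum_nonneg fun i _ => hs i) hX hlt
  exact h (exists_isFirstBreakpoint hr hb)

open Classical in
-- Shares do not decrease from round to round: with `t` the first breakpoint, suppliers served later
-- get at least `t` or their peaks. The level `t` is arbitrary so that the induction can pass to
-- `max t r` in the residual problem.
theorem min_le_egalitarianShare (hs : ∀ i, 0 ≤ N.supply i) (hd : ∀ j, 0 ≤ N.demand j)
    (S : Finset A) (D : Finset B) {t : ℝ}
    (ht : ∀ X ⊆ S, ∑ i ∈ X, min t (N.supply i) ≤ ∑ j ∈ N.neighbors D X, N.demand j) :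
    ∀ i ∈ S, min t (N.supply i) ≤ N.egalitarianShare S D i := by
  induction hn : S.card using Nat.strong_induction_on generalizing S D t with
  | _ n ih =>
  intro i hi
  rw [egalitarianShare]
  split_ifs with h
  swap
  · exact min_le_right _ _
  have hr := h.choose_spec
  generalize h.choose = r at hr
  set Y := N.largestBottleneck S D r with hY
  have hYS : Y ⊆ S := largestBottleneck_subset N S D r
  have hYe : ∑ i ∈ Y, min r (N.supply i) = ∑ j ∈ N.neighbors D Y, N.demand j :=
    hr.sum_largestBottleneck hs hd
  beta_reduce
  split_ifs with hiY
  · rcases le_total t r with htr | hrt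
    · exact min_le_min_right _ htr
    -- `Y` is already exhausted at level `r`, so raising the level to `t` changes nothing on `Y`.
    · have hle : ∀ k ∈ Y, min r (N.supply k) ≤ min t (N.supply k) :=
        fun k _ => min_le_min_right _ hrt
      have heq := (Finset.sum_eq_sum_iff_of_le hle).1
        (le_antisymm (Finset.sum_le_sum hle) (hYe ▸ ht Y hYS))
      exact (heq i hiY).ge
  · refine (min_le_min_right _ (le_max_left t r)).trans ?_
    refine ih _ ?_ (S \ Y) (D \ N.neighbors D Y) ?_ rfl i (Finset.mem_sdiff.2 ⟨hi, hiY⟩)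
    · rw [← hn]
      exact Finset.card_lt_card (Finset.sdiff_ssubset hYS hr.nonempty)
    · intro X hX
      have hdisj : Disjoint X Y := Finset.disjoint_of_subset_left hX Finset.sdiff_disjoint
      have hXS : X ∪ Y ⊆ S := Finset.union_subset (hX.trans Finset.sdiff_subset) hYS
      have hm : ∑ i ∈ X ∪ Y, min (max t r) (N.supply i) ≤
          ∑ j ∈ N.neighbors D (X ∪ Y), N.demand j := by
        rcases max_choice t r with he | he <;> rw [he]
        · exact ht _ hXS
        · exact hr.sum_le hs hd hXS
      rw [Finset.sum_union hdisj, sum_neighbors_union, ← hYe] at hm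
      have := Finset.sum_le_sum fun k (_ : k ∈ Y) =>
        min_le_min_right (N.supply k) (le_max_right t r)
      linarith

open Classical in
theorem isEgalitarian_egalitarianShare (hs : ∀ i, 0 ≤ N.supply i) (hd : ∀ j, 0 ≤ N.demand j)
    (S : Finset A) (D : Finset B) : N.IsEgalitarian S D (N.egalitarianShare S D) := by
  induction hn : S.card using Nat.strong_induction_on generalizing S D with
  | _ n ih =>
  by_cases h : ∃ t, N.IsFirstBreakpoint S D t
  swap
  · rw [egalitarianShare, dif_neg h]
    exact ⟨fun i _ => hs i, fun i _ => le_rfl, fun X hX => sum_supply_le hs hd h hX,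
      fun i _ hi => absurd hi (lt_irrefl _)⟩
  have hlow := fun t ht => min_le_egalitarianShare hs hd S D (t := t) ht
  rw [egalitarianShare, dif_pos h] at hlow ⊢
  have hr := h.choose_spec
  generalize h.choose = r at hr hlow
  set Y := N.largestBottleneck S D r with hY
  have hYS : Y ⊆ S := largestBottleneck_subset N S D r
  have hYe : ∑ i ∈ Y, min r (N.supply i) = ∑ j ∈ N.neighbors D Y, N.demand j :=
    hr.sum_largestBottleneck hs hd
  have hz := ih _ (hn ▸ Finset.card_lt_card (Finset.sdiff_ssubset hYS hr.nonempty))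
    (S \ Y) (D \ N.neighbors D Y) rfl
  set z := N.egalitarianShare (S \ Y) (D \ N.neighbors D Y) with hzdef
  set x : A → ℝ := fun i => if i ∈ Y then min r (N.supply i) else z i with hx
  have hxY : ∀ i ∈ Y, x i = min r (N.supply i) := fun i hi => if_pos hi
  have hxz : ∀ i ∉ Y, x i = z i := fun i hi => if_neg hi
  have hlow := hlow r fun X hX => hr.sum_le hs hd hX
  refine ⟨fun i hi => (le_min hr.1.1 (hs i)).trans (hlow i hi), fun i hi => ?_, fun X hX => ?_,
    fun i hi hlt => ?_⟩
  · by_cases hiY : i ∈ Y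
    · rw [hxY i hiY]
      exact min_le_right _ _
    · rw [hxz i hiY]
      exact hz.le_supply i (Finset.mem_sdiff.2 ⟨hi, hiY⟩)
  · have h1 : ∑ i ∈ X ∩ Y, x i ≤ ∑ j ∈ N.neighbors D (X ∩ Y), N.demand j := by
      rw [Finset.sum_congr rfl fun i hi => hxY i (Finset.mem_inter.1 hi).2]
      exact hr.sum_le hs hd (Finset.inter_subset_left.trans hX)
    have h2 : ∑ i ∈ X \ Y, x i ≤
        ∑ j ∈ N.neighbors (D \ N.neighbors D Y) (X \ Y), N.demand j := by
      rw [Finset.sum_congr rfl fun i hi => hxz i (Finset.mem_sdiff.1 hi).2]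
      exact hz.sum_le _ (Finset.sdiff_subset_sdiff hX subset_rfl)
    rw [← Finset.sum_inter_add_sum_sdiff X Y]
    refine (add_le_add h1 h2).trans ?_
    rw [← Finset.sum_union]
    · refine Finset.sum_le_sum_of_subset_of_nonneg (fun j hj => ?_) fun j _ _ => hd j
      simp only [mem_neighbors, Finset.mem_union, Finset.mem_sdiff, Finset.mem_inter] at hj ⊢
      grind
    · rw [Finset.disjoint_left]
      intro j hj hj'
      exact (Finset.mem_sdiff.1 (mem_neighbors.1 hj').1).2
        (neighbors_mono Finset.inter_subset_right hj)
  -- A supplier below his peak gets at least `r`, so `Y`, where shares are at most `r`, can be added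
  -- to his tight set in the residual problem.
  · have hri : r ≤ x i := by
      have hmin : min r (N.supply i) ≤ x i := hlow i hi
      exact (min_le_iff.1 hmin).resolve_right hlt.not_ge
    have hYx : ∑ k ∈ Y, x k = ∑ j ∈ N.neighbors D Y, N.demand j := by
      rw [Finset.sum_congr rfl hxY, hYe]
    have hYi : ∀ k ∈ Y, x k ≤ x i := fun k hk => by
      rw [hxY k hk]
      exact (min_le_left _ _).trans hri
    by_cases hiY : i ∈ Y
    · exact ⟨Y, hYS, hiY, hYx, hYi⟩
    · obtain ⟨T, hTS, hiT, hT, hTi⟩ := hz.exists_tight i (Finset.mem_sdiff.2 ⟨hi, hiY⟩)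
        (hxz i hiY ▸ hlt)
      have hTY : ∀ k ∈ T, k ∉ Y := fun k hk => (Finset.mem_sdiff.1 (hTS hk)).2
      refine ⟨T ∪ Y, Finset.union_subset (hTS.trans Finset.sdiff_subset) hYS,
        Finset.mem_union_left _ hiT, ?_, fun k hk => ?_⟩
      · rw [Finset.sum_union (Finset.disjoint_left.2 hTY), sum_neighbors_union, hYx, ← hT,
          Finset.sum_congr rfl fun k hk => hxz k (hTY k hk)]
      · rcases Finset.mem_union.1 hk with hk | hk
        · rw [hxz k (hTY k hk), hxz i hiY]
          exact hTi k hk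
        · exact hYi k hk

/-- The fair point is unique. -/
theorem IsEgalitarian.eq {x y : A → ℝ} (hx : N.IsEgalitarian S D x)
    (hy : N.IsEgalitarian S D y) : ∀ i ∈ S, x i = y i := by
  -- In the tight set of `i`, `y` cannot have a larger sum than `x`; a gain at `i` is offset by a
  -- loss at some `k` with `x k ≤ x i`.
  have key : ∀ {x y : A → ℝ}, N.IsEgalitarian S D x → N.IsEgalitarian S D y →
      ∀ i ∈ S, x i < y i → ∃ k ∈ S, y k < x k ∧ x k ≤ x i := by
    intro x y hx hy i hi hlt
    obtain ⟨T, hTS, hiT, hT, hTi⟩ := hx.exists_tight i hi (hlt.trans_le (hy.le_supply i hi))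
    by_contra! hno
    have : ∑ k ∈ T, x k < ∑ k ∈ T, y k := by
      refine Finset.sum_lt_sum (fun k hk => ?_) ⟨i, hiT, hlt⟩
      by_contra! hk'
      exact absurd (hTi k hk) (hno k (hTS hk) hk').not_ge
    exact (this.trans_le (hy.sum_le T hTS)).ne hT
  by_contra! hne
  obtain ⟨i₀, hi₀, hne₀⟩ := hne
  -- Where `x` and `y` differ, take the least value of either one; `key` then finds a smaller one.
  obtain ⟨i, hi, hmin⟩ := Finset.exists_min_image (S.filter fun i => x i ≠ y i)
    (fun i => min (x i) (y i)) ⟨i₀, by simp [hi₀, hne₀]⟩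
  rw [Finset.mem_filter] at hi
  rcases lt_or_gt_of_ne hi.2 with hlt | hlt
  · obtain ⟨k, hk, h1, h2⟩ := key hx hy i hi.1 hlt
    have := hmin k (Finset.mem_filter.2 ⟨hk, h1.ne'⟩)
    rw [min_eq_left hlt.le, min_eq_right h1.le] at this
    linarith
  · obtain ⟨k, hk, h1, h2⟩ := key hy hx i hi.1 hlt
    have := hmin k (Finset.mem_filter.2 ⟨hk, h1.ne⟩)
    rw [min_eq_right hlt.le, min_eq_left h1.le] at this
    linarith

open Classical in
/-- The fair point is majorized from below by every other point of the polymatroid. -/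
theorem IsEgalitarian.sum_min_le (hd : ∀ j, 0 ≤ N.demand j) {x w : A → ℝ}
    (hx : N.IsEgalitarian S D x) (hws : ∀ i ∈ S, w i ≤ N.supply i)
    (hw : ∀ X ⊆ S, ∑ i ∈ X, w i ≤ ∑ j ∈ N.neighbors D X, N.demand j) (t : ℝ) :
    ∑ i ∈ S, min (w i) t ≤ ∑ i ∈ S, min (x i) t := by
  choose! T hTS hiT hT hTi using hx.exists_tight
  -- The tight sets of the agents in `I` stay below `t`, so on their union the cap at `t` is void
  -- for `x`, and tightness bounds `w`. Any other agent has `x i ≥ t` or his peak.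
  set I := S.filter fun i => x i < N.supply i ∧ x i < t with hI
  have hIm : ∀ i ∈ I, i ∈ S ∧ x i < N.supply i ∧ x i < t := fun i hi => Finset.mem_filter.1 hi
  have hU := tight_biUnion hd hx.sum_le I T (fun i hi => hTS i (hIm i hi).1 (hIm i hi).2.1)
    fun i hi => hT i (hIm i hi).1 (hIm i hi).2.1
  set U := I.biUnion T with hUdef
  have hUS : U ⊆ S :=
    Finset.biUnion_subset.2 fun i hi => hTS i (hIm i hi).1 (hIm i hi).2.1
  have hUt : ∀ k ∈ U, x k < t := by
    intro k hk
    obtain ⟨i, hi, hk⟩ := Finset.mem_biUnion.1 hk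
    exact (hTi i (hIm i hi).1 (hIm i hi).2.1 k hk).trans_lt (hIm i hi).2.2
  rw [← Finset.sum_sdiff hUS, ← Finset.sum_sdiff hUS]
  refine add_le_add (Finset.sum_le_sum fun i hi => ?_) ?_
  · rw [Finset.mem_sdiff] at hi
    rcases lt_or_ge (x i) t with hlt | hge
    · have hxi : N.supply i ≤ x i := by
        by_contra! hlt'
        exact hi.2 (Finset.mem_biUnion.2
          ⟨i, Finset.mem_filter.2 ⟨hi.1, hlt', hlt⟩, hiT i hi.1 hlt'⟩)
      exact min_le_min_right _ ((hws i hi.1).trans hxi)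
    · rw [min_eq_right hge]
      exact min_le_right _ _
  · calc ∑ i ∈ U, min (w i) t ≤ ∑ i ∈ U, w i := Finset.sum_le_sum fun i _ => min_le_left _ _
      _ ≤ ∑ i ∈ U, x i := (hw U hUS).trans hU.ge
      _ = ∑ i ∈ U, min (x i) t :=
        Finset.sum_congr rfl fun i hi => (min_eq_left (hUt i hi).le).symm

end BipartiteNetwork

/-! ### Shipments with prescribed margins -/

namespace BipartiteNetwork

open Classical in
/-- The marriage theorem for shipments: if every set `X` of suppliers has neighbors with a total
demand of at least the supply of `X`, and total supply equals total demand, then all of the supply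
can be shipped. -/
theorem exists_shipment {A B : Type*} [Fintype A] [Fintype B] (E : A → B → Prop)
    {r : A → ℝ} {c : B → ℝ} (hc : ∀ j, 0 ≤ c j)
    (htot : ∑ i, r i = ∑ j, c j)
    (hall : ∀ X : Finset A, ∑ i ∈ X, r i ≤ ∑ j with ∃ i ∈ X, E i j, c j) :
    ∃ g : A → B → ℝ, (∀ i j, 0 ≤ g i j) ∧ (∀ i j, ¬ E i j → g i j = 0) ∧
      (∀ i, ∑ j, g i j = r i) ∧ ∀ j, ∑ i, g i j = c j := by
  -- Among the shipments with the right column sums, take one whose row sums are closest to `r` in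
  -- the squared distance.
  set K : Set (A → B → ℝ) := {g | (∀ i j, 0 ≤ g i j) ∧ (∀ i j, ¬ E i j → g i j = 0) ∧
    ∀ j, ∑ i, g i j = c j} with hK
  have hKcl : IsClosed K := by
    have hKi : K = (⋂ i, ⋂ j, {g | 0 ≤ g i j}) ∩ ((⋂ i, ⋂ j, ⋂ _ : ¬ E i j, {g | g i j = 0}) ∩
        ⋂ j, {g | ∑ i, g i j = c j}) := by
      ext g
      simp [hK]
    rw [hKi]
    refine IsClosed.inter ?_ (IsClosed.inter ?_ ?_)
    · exact isClosed_iInter fun i => isClosed_iInter fun j =>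
        isClosed_le continuous_const (by fun_prop)
    · exact isClosed_iInter fun i => isClosed_iInter fun j => isClosed_iInter fun _ =>
        isClosed_eq (by fun_prop) continuous_const
    · exact isClosed_iInter fun j => isClosed_eq (by fun_prop) continuous_const
  have hKc : IsCompact K := by
    refine (isCompact_Icc (a := 0) (b := fun _ j => c j)).of_isClosed_subset hKcl fun g hg => ?_
    refine ⟨fun i j => hg.1 i j, fun i j => ?_⟩
    beta_reduce
    rw [← hg.2.2 j]
    exact Finset.single_le_sum (fun k _ => hg.1 k j) (Finset.mem_univ i)
  have hKn : K.Nonempty := by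
    -- A sink with positive demand and no neighbor would violate the Hall condition for the set of
    -- all sources.
    have hn : ∀ j, c j ≠ 0 → ∃ i, E i j := by
      intro j hj
      by_contra! hno
      refine (hall Finset.univ).not_gt ?_
      rw [htot]
      exact Finset.sum_lt_sum_of_subset (Finset.filter_subset _ _) (Finset.mem_univ j)
        (by simp [hno]) (lt_of_le_of_ne (hc j) hj.symm) fun k _ _ => hc k
    choose m hm using hn
    refine ⟨fun i j => if h : c j = 0 then 0 else if i = m j h then c j else 0,
      fun i j => ?_, fun i j hE => ?_, fun j => ?_⟩
    · beta_reduce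
      split_ifs
      · exact le_rfl
      · exact hc j
      · exact le_rfl
    · beta_reduce
      split_ifs with h hi
      · rfl
      · exact absurd (hi ▸ hm j h) hE
      · rfl
    · by_cases h : c j = 0 <;> simp [h]
  obtain ⟨g, hg, hmin⟩ := hKc.exists_isMinOn hKn
    (f := fun g => ∑ i, (∑ j, g i j - r i) ^ 2) (by fun_prop)
  set e : A → ℝ := fun i => ∑ j, g i j - r i with he
  -- Otherwise moving `δ` units into `j` from `i` to `i'` changes the objective by `2 * δ * (e i' -
  -- e i + δ)`, which is negative since `δ ≤ (e i - e i') / 2`.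
  have hswap : ∀ i i' j, 0 < g i j → E i' j → e i ≤ e i' := by
    intro i i' j hpos hE
    by_contra! hlt
    have hne : i ≠ i' := by
      rintro rfl
      exact lt_irrefl _ hlt
    set δ := min (g i j) ((e i - e i') / 2) with hδ
    have hδ0 : 0 < δ := lt_min hpos (by linarith)
    have hδ1 : δ ≤ g i j := min_le_left _ _
    have hδ2 : δ ≤ (e i - e i') / 2 := min_le_right _ _
    set u : A → ℝ := fun k => (if k = i' then δ else 0) - (if k = i then δ else 0) with hu
    set g' : A → B → ℝ := fun k l => g k l + if l = j then u k else 0 with hg'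
    have hmem : g' ∈ K := by
      refine ⟨fun k l => ?_, fun k l hkl => ?_, fun l => ?_⟩
      · have := hg.1 k l
        simp only [hg', hu]
        split_ifs <;> subst_vars <;> linarith
      · have h0 := hg.2.1 k l hkl
        simp only [hg', hu, h0]
        split_ifs <;> subst_vars <;> first | linarith | contradiction
      · simp only [hg', Finset.sum_add_distrib, hg.2.2 l]
        split_ifs
        · simp [hu]
        · simp
    have hrow : ∀ k, ∑ l, g' k l - r k = e k + u k := by
      intro k
      simp only [hg', Finset.sum_add_distrib, he]
      rw [Finset.sum_ite_eq' Finset.univ j, if_pos (Finset.mem_univ j)]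
      ring
    have hle : ∑ k, e k ^ 2 ≤ ∑ k, (∑ l, g' k l - r k) ^ 2 := hmin hmem
    simp only [hrow] at hle
    have hsum : ∑ k, (e k + u k) ^ 2 =
        ∑ k, e k ^ 2 + (2 * e i' * δ - 2 * e i * δ + 2 * δ ^ 2) := by
      have hk : ∀ k, (e k + u k) ^ 2 = e k ^ 2 +
          ((if k = i' then 2 * e k * δ + δ ^ 2 else 0) +
            if k = i then - (2 * e k * δ) + δ ^ 2 else 0) := by
        intro k
        simp only [hu]
        split_ifs with h1 h2
        · exact absurd (h2.symm.trans h1) hne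
        all_goals ring
      simp only [hk, Finset.sum_add_distrib, Finset.sum_ite_eq', Finset.mem_univ, if_true]
      ring
    rw [hsum] at hle
    nlinarith
  have htotal : ∑ i, e i = 0 := by
    simp only [he, Finset.sum_sub_distrib]
    rw [Finset.sum_comm, htot, sub_eq_zero]
    exact Finset.sum_congr rfl fun j _ => hg.2.2 j
  have hpos : ∀ i, 0 ≤ e i := by
    by_contra! hneg
    obtain ⟨i₁, hi₁⟩ := hneg
    obtain ⟨i₀, -, hi₀⟩ := Finset.exists_min_image Finset.univ e ⟨i₁, Finset.mem_univ _⟩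
    -- By `hswap`, everything arriving at neighbors of the rows with least excess comes from these
    -- rows. If that excess is negative, `X` violates the Hall condition.
    set X : Finset A := Finset.univ.filter fun i => e i = e i₀ with hX
    have hX' : ∀ i, i ∈ X ↔ e i = e i₀ := fun i => by simp [hX]
    have hlt : ∑ i ∈ X, ∑ j, g i j < ∑ i ∈ X, r i := by
      refine Finset.sum_lt_sum_of_nonempty ⟨i₀, (hX' _).2 rfl⟩ fun i hi => ?_
      have h1 : e i < 0 := ((hX' i).1 hi).trans_lt ((hi₀ i₁ (Finset.mem_univ _)).trans_lt hi₁)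
      simpa [he] using h1
    have hge : ∑ j with ∃ i ∈ X, E i j, c j ≤ ∑ i ∈ X, ∑ j, g i j := by
      rw [Finset.sum_comm]
      refine (Finset.sum_le_sum fun j hj => ?_).trans (Finset.sum_le_sum_of_subset_of_nonneg
        (Finset.filter_subset _ _) fun j _ _ => Finset.sum_nonneg fun i _ => hg.1 i j)
      obtain ⟨-, i', hi', hE⟩ := Finset.mem_filter.1 hj
      rw [← hg.2.2 j]
      refine (Finset.sum_subset (Finset.subset_univ X) fun i _ hi => ?_).ge
      by_contra hgi
      have h2 := hswap i i' j (lt_of_le_of_ne (hg.1 i j) (Ne.symm hgi)) hE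
      rw [(hX' i').1 hi'] at h2
      exact hi ((hX' i).2 (le_antisymm h2 (hi₀ i (Finset.mem_univ _))))
    exact absurd (hall X) (hge.trans_lt hlt).not_ge
  have hzero := (Finset.sum_eq_zero_iff_of_nonneg fun i _ => hpos i).1 htotal
  exact ⟨g, hg.1, hg.2.1, fun i => sub_eq_zero.1 (hzero i (Finset.mem_univ i)), hg.2.2⟩

end BipartiteNetwork

/-! ### The doubled network and feasible exchanges -/

namespace BipartiteNetwork

theorem reverse_doubled {V : Type*} (G : SimpleGraph V) (b : V → ℝ) :
    (Exchange.doubled G b).reverse = Exchange.doubled G b := by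
  simp only [reverse, Exchange.doubled, G.adj_comm]

end BipartiteNetwork

namespace Exchange

variable {V : Type*} [Fintype V] {G : SimpleGraph V} {b : V → ℝ}

theorem egalitarianDemand_doubled (G : SimpleGraph V) (b : V → ℝ) :
    (doubled G b).egalitarianDemand = (doubled G b).egalitarianSupply := by
  rw [BipartiteNetwork.egalitarianDemand, BipartiteNetwork.reverse_doubled]
  rfl

theorem egalitarianRule_eq (G : SimpleGraph V) (b : V → ℝ) :
    egalitarianRule G b = (doubled G b).egalitarianSupply := by
  ext i
  simp [egalitarianRule, egalitarianDemand_doubled]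

/-- The allocation `x` is the fair point of the polymatroid of the doubled network. -/
abbrev IsFair (G : SimpleGraph V) (b x : V → ℝ) : Prop :=
  (doubled G b).IsEgalitarian Finset.univ Finset.univ x

theorem isFair_egalitarianRule (hb : ∀ i, 0 ≤ b i) : IsFair G b (egalitarianRule G b) := by
  rw [egalitarianRule_eq]
  exact BipartiteNetwork.isEgalitarian_egalitarianShare hb hb _ _

theorem mem_neighbors_doubled {X : Finset V} {j : V} :
    j ∈ (doubled G b).neighbors Finset.univ X ↔ ∃ i ∈ X, G.Adj i j := by
  simp [BipartiteNetwork.mem_neighbors, doubled]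

theorem neighbors_doubled_congr (b b' : V → ℝ) (X : Finset V) :
    (doubled G b).neighbors Finset.univ X = (doubled G b').neighbors Finset.univ X := by
  ext j
  simp only [mem_neighbors_doubled]

theorem isFeasibleFlow_toFlow {f : V → V → ℝ} (hf : IsFeasibleExchange G b f) :
    (doubled G b).IsFeasibleFlow (toFlow f) where
  nonneg := hf.nonneg
  support := hf.support
  conservation_left _ := rfl
  conservation_right j := Finset.sum_congr rfl fun i _ => hf.symm i j
  supply_le := hf.le_peak
  demand_le := hf.le_peak

theorem allocation_symmetrize {φ : BipartiteFlow V V} (h : (doubled G b).IsFeasibleFlow φ)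
    (i : V) : allocation (symmetrize φ) i = (φ.src i + φ.snk i) / 2 := by
  simp only [allocation, symmetrize]
  rw [← Finset.sum_div, Finset.sum_add_distrib, h.conservation_left, h.conservation_right]

theorem isFeasibleExchange_symmetrize {φ : BipartiteFlow V V}
    (h : (doubled G b).IsFeasibleFlow φ) : IsFeasibleExchange G b (symmetrize φ) where
  nonneg i j := by
    have h1 := h.nonneg i j
    have h2 := h.nonneg j i
    simp only [symmetrize]
    linarith
  support i j hij := by
    have h1 := h.support i j hij
    have h2 := h.support j i fun hji => hij (G.adj_symm hji)
    simp [symmetrize, h1, h2]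
  symm i j := by
    simp only [symmetrize]
    ring
  le_peak i := by
    have h1 : φ.src i ≤ b i := h.supply_le i
    have h2 : φ.snk i ≤ b i := h.demand_le i
    rw [allocation_symmetrize h]
    linarith

theorem IsFeasibleAllocation.nonneg {x : V → ℝ} (h : IsFeasibleAllocation G b x) (i : V) :
    0 ≤ x i := by
  obtain ⟨f, hf, rfl⟩ := h
  exact Finset.sum_nonneg fun j _ => hf.nonneg i j

theorem IsFeasibleAllocation.le_peak {x : V → ℝ} (h : IsFeasibleAllocation G b x) (i : V) :
    x i ≤ b i := by
  obtain ⟨f, hf, rfl⟩ := h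
  exact hf.le_peak i

/-- What `X` exchanges goes to its neighbors, and by symmetry of `f` counts against their peaks. -/
theorem IsFeasibleAllocation.sum_le {x : V → ℝ} (h : IsFeasibleAllocation G b x)
    (X : Finset V) : ∑ i ∈ X, x i ≤ ∑ j ∈ (doubled G b).neighbors Finset.univ X, b j := by
  obtain ⟨f, hf, rfl⟩ := h
  calc ∑ i ∈ X, ∑ j, f i j
      = ∑ i ∈ X, ∑ j ∈ (doubled G b).neighbors Finset.univ X, f i j := by
        refine Finset.sum_congr rfl fun i hi =>
          (Finset.sum_subset (Finset.subset_univ _) fun j _ hj => hf.support i j fun hij => ?_).symm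
        exact hj (mem_neighbors_doubled.2 ⟨i, hi, hij⟩)
    _ = ∑ j ∈ (doubled G b).neighbors Finset.univ X, ∑ i ∈ X, f j i := by
        rw [Finset.sum_comm]
        simp only [hf.symm]
    _ ≤ _ := Finset.sum_le_sum fun j _ =>
        (Finset.sum_le_sum_of_subset_of_nonneg (Finset.subset_univ X)
          fun i _ _ => hf.nonneg j i).trans (hf.le_peak j)

/-! ### Tight sets in the doubled network and realization of the fair point -/

/-- The agents who are below their peaks lie in a set that exhausts its neighbors. -/
theorem IsFair.exists_tight_all (hb : ∀ i, 0 ≤ b i) {x : V → ℝ} (hx : IsFair G b x) :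
    ∃ T : Finset V, (∀ i ∉ T, x i = b i) ∧
      ∑ i ∈ T, x i = ∑ j ∈ (doubled G b).neighbors Finset.univ T, b j := by
  classical
  choose! T hTS hiT hT hTi using hx.exists_tight
  refine ⟨(Finset.univ.filter fun i => x i < b i).biUnion T, fun i hi => ?_, ?_⟩
  · by_contra hne
    have hlt := lt_of_le_of_ne (hx.le_supply i (Finset.mem_univ i)) hne
    exact hi (Finset.mem_biUnion.2 ⟨i, Finset.mem_filter.2 ⟨Finset.mem_univ i, hlt⟩, hiT i (Finset.mem_univ i) hlt⟩)
  · refine BipartiteNetwork.tight_biUnion (N := doubled G b) hb hx.sum_le _ _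
      (fun i _ => Finset.subset_univ _) fun i hi => ?_
    exact hT i (Finset.mem_univ i) (Finset.mem_filter.1 hi).2

/-- The neighbors of a set that exhausts all of them get their peaks, if all agents outside of the
set get their peaks. -/
theorem IsFair.eq_peak_of_mem_neighbors {x : V → ℝ} (hb : ∀ i, 0 ≤ b i)
    (hx : IsFair G b x) {T : Finset V} (hTc : ∀ i ∉ T, x i = b i)
    (hT : ∑ i ∈ T, x i = ∑ j ∈ (doubled G b).neighbors Finset.univ T, b j) :
    ∀ i ∈ (doubled G b).neighbors Finset.univ T, x i = b i := by
  classical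
  set M := (doubled G b).neighbors Finset.univ T with hM
  -- Agents outside `M = N(T)` have no neighbor in `T`. As `x = b` off `T`, this gives `x(Mᶜ) ≤
  -- x(Tᶜ)`, hence `x(M) ≥ x(T) = b(M)`.
  have h1 : ∑ i ∈ Mᶜ, x i ≤ ∑ j ∈ Tᶜ, b j := by
    refine (hx.sum_le Mᶜ (Finset.subset_univ _)).trans
      (Finset.sum_le_sum_of_subset_of_nonneg (fun j hj => ?_) fun j _ _ => hb j)
    obtain ⟨i, hi, hij⟩ := mem_neighbors_doubled.1 hj
    rw [Finset.mem_compl] at hi ⊢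
    exact fun hjT => hi (mem_neighbors_doubled.2 ⟨j, hjT, hij.symm⟩)
  have h2 : ∑ i ∈ Tᶜ, x i = ∑ j ∈ Tᶜ, b j :=
    Finset.sum_congr rfl fun i hi => hTc i (Finset.mem_compl.1 hi)
  have h3 := Finset.sum_add_sum_compl M x
  have h4 := Finset.sum_add_sum_compl T x
  have hle : ∀ i ∈ M, x i ≤ b i := fun i _ => hx.le_supply i (Finset.mem_univ i)
  exact (Finset.sum_eq_sum_iff_of_le hle).1
    (le_antisymm (Finset.sum_le_sum hle) (by linarith))

/-- Enlarge `T` by a tight set containing all agents below their peaks; the neighbors of the union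
get their peaks. -/
theorem IsFair.not_mem_neighbors {x : V → ℝ} (hb : ∀ i, 0 ≤ b i) (hx : IsFair G b x)
    {T : Finset V} (hT : ∑ i ∈ T, x i = ∑ j ∈ (doubled G b).neighbors Finset.univ T, b j)
    {i : V} (hi : x i < b i) : i ∉ (doubled G b).neighbors Finset.univ T := by
  classical
  obtain ⟨U, hUc, hU⟩ := hx.exists_tight_all hb
  have hTU := BipartiteNetwork.tight_union (N := doubled G b) hb hx.sum_le (Finset.subset_univ T)
    (Finset.subset_univ U) hT hU
  intro hiT
  exact hi.ne (hx.eq_peak_of_mem_neighbors hb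
    (fun k hk => hUc k fun hkU => hk (Finset.mem_union_right _ hkU)) hTU i
    (BipartiteNetwork.neighbors_mono Finset.subset_union_left hiT))

/-- The Hall condition with shares, not peaks, on the right. With `T` tight, `x = b` off `T` and `M
= N(T)`, the part `X \ M` has neighbors only outside `T`, where shares are peaks, while `X ∩ M` is
charged to its neighbors inside `T`. -/
theorem IsFair.sum_le_sum_neighbors {x : V → ℝ} (hb : ∀ i, 0 ≤ b i) (hx : IsFair G b x)
    (X : Finset V) :
    ∑ i ∈ X, x i ≤ ∑ j ∈ (doubled G b).neighbors Finset.univ X, x j := by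
  classical
  obtain ⟨T, hTc, hT⟩ := hx.exists_tight_all hb
  have hTn := hx.eq_peak_of_mem_neighbors hb hTc hT
  set M := (doubled G b).neighbors Finset.univ T with hM
  set n : Finset V → Finset V := fun X => (doubled G b).neighbors Finset.univ X with hn
  have hmem : ∀ {Y : Finset V} {j : V}, j ∈ n Y ↔ ∃ i ∈ Y, G.Adj i j := mem_neighbors_doubled
  have h1 : ∑ i ∈ X ∩ M, x i ≤ ∑ j ∈ T ∩ n (X ∩ M), x j := by
    -- The agents of `T` not adjacent to `X ∩ M` can only use the rest of `M`. Subtracting from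
    -- `x(T) = b(M)` leaves at least `b(X ∩ M) = x(X ∩ M)` for the others.
    have hZ : ∑ i ∈ T \ n (X ∩ M), x i ≤ ∑ j ∈ M \ (X ∩ M), b j := by
      refine (hx.sum_le _ (Finset.subset_univ _)).trans
        (Finset.sum_le_sum_of_subset_of_nonneg (fun j hj => ?_) fun j _ _ => hb j)
      obtain ⟨i, hi, hij⟩ := hmem.1 hj
      rw [Finset.mem_sdiff] at hi ⊢
      exact ⟨hmem.2 ⟨i, hi.1, hij⟩, fun hj' => hi.2 (hmem.2 ⟨j, hj', hij.symm⟩)⟩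
    have h2 := Finset.sum_inter_add_sum_sdiff T (n (X ∩ M)) x
    have h3 := Finset.sum_sdiff (f := b) (Finset.inter_subset_right : X ∩ M ⊆ M)
    have h4 := Finset.sum_congr (rfl : X ∩ M = X ∩ M)
      fun i hi => hTn i (Finset.mem_inter.1 hi).2
    linarith
  have h2 : ∑ i ∈ X \ M, x i ≤ ∑ j ∈ n (X \ M), x j := by
    refine (hx.sum_le _ (Finset.subset_univ _)).trans (Finset.sum_le_sum fun j hj => ?_)
    obtain ⟨i, hi, hij⟩ := mem_neighbors_doubled.1 hj
    refine (hTc j fun hjT => ?_).ge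
    exact (Finset.mem_sdiff.1 hi).2 (mem_neighbors_doubled.2 ⟨j, hjT, hij.symm⟩)
  rw [← Finset.sum_inter_add_sum_sdiff X M]
  refine (add_le_add h1 h2).trans ?_
  rw [← Finset.sum_union]
  · refine Finset.sum_le_sum_of_subset_of_nonneg (fun j hj => ?_)
      fun j _ _ => hx.nonneg j (Finset.mem_univ j)
    rcases Finset.mem_union.1 hj with hj | hj
    · exact BipartiteNetwork.neighbors_mono Finset.inter_subset_left (Finset.mem_inter.1 hj).2
    · exact BipartiteNetwork.neighbors_mono Finset.sdiff_subset hj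
  · rw [Finset.disjoint_left]
    intro j hj hj'
    obtain ⟨i, hi, hij⟩ := hmem.1 hj'
    exact (Finset.mem_sdiff.1 hi).2
      (mem_neighbors_doubled.2 ⟨j, (Finset.mem_inter.1 hj).1, hij.symm⟩)

theorem IsFair.exists_flow {x : V → ℝ} (hb : ∀ i, 0 ≤ b i) (hx : IsFair G b x) :
    ∃ φ, (doubled G b).IsFeasibleFlow φ ∧ φ.src = x ∧ φ.snk = x := by
  have hx0 : ∀ i, 0 ≤ x i := fun i => hx.nonneg i (Finset.mem_univ i)
  obtain ⟨g, hg0, hgE, hgr, hgc⟩ := BipartiteNetwork.exists_shipment G.Adj hx0 rfl fun X => by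
    convert hx.sum_le_sum_neighbors hb X using 2
    ext j
    simp [mem_neighbors_doubled]
  exact ⟨⟨x, g, x⟩, ⟨hg0, hgE, fun i => (hgr i).symm, hgc,
    fun i => hx.le_supply i (Finset.mem_univ i), fun i => hx.le_supply i (Finset.mem_univ i)⟩,
    rfl, rfl⟩

theorem IsFair.isFeasibleAllocation {x : V → ℝ} (hb : ∀ i, 0 ≤ b i) (hx : IsFair G b x) :
    IsFeasibleAllocation G b x := by
  obtain ⟨φ, hφ, h1, h2⟩ := hx.exists_flow hb
  refine ⟨symmetrize φ, isFeasibleExchange_symmetrize hφ, ?_⟩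
  ext i
  rw [allocation_symmetrize hφ, h1, h2]
  ring

/-! ### Pareto optimality, envy and strategyproofness -/

theorem IsSinglePeaked.refl {R : ℝ → ℝ → Prop} {p a : ℝ} (hR : IsSinglePeaked R p)
    (ha : 0 ≤ a) : R a a :=
  (hR.total a a ha ha).elim id id

/-- Below the peak, more is better. -/
theorem IsSinglePeaked.le_of_rel {R : ℝ → ℝ → Prop} {p a c : ℝ} (hR : IsSinglePeaked R p)
    (ha : 0 ≤ a) (hc : c ≤ p) (h : R a c) : c ≤ a := by
  by_contra! hlt
  exact (hR.below c a ha hlt hc).2 h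

/-- Since `x ≤ b`, a weak improvement is at least `x` in every coordinate. It cannot exceed `x` on a
tight set, nor at an agent who has his peak. -/
theorem IsFair.isParetoOptimal {x : V → ℝ} (hb : ∀ i, 0 ≤ b i) (hx : IsFair G b x)
    {R : V → ℝ → ℝ → Prop} (hR : ∀ i, IsSinglePeaked (R i) (b i)) :
    IsParetoOptimal G b R x := by
  classical
  refine ⟨hx.isFeasibleAllocation hb, fun x' hx' hRx => ?_⟩
  have hle : ∀ i, x i ≤ x' i := fun i =>
    (hR i).le_of_rel (hx'.nonneg i) (hx.le_supply i (Finset.mem_univ i)) (hRx i)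
  obtain ⟨T, hTc, hT⟩ := hx.exists_tight_all hb
  have hsum : ∑ i ∈ T, x' i ≤ ∑ i ∈ T, x i := (hx'.sum_le T).trans hT.ge
  have heq := (Finset.sum_eq_sum_iff_of_le fun i (_ : i ∈ T) => hle i).1
    (le_antisymm (Finset.sum_le_sum fun i _ => hle i) hsum)
  intro i
  have hi : x' i = x i := by
    by_cases hiT : i ∈ T
    · exact (heq i hiT).symm
    · exact le_antisymm ((hx'.le_peak i).trans (hTc i hiT).ge) (hle i)
  rw [hi]
  exact ⟨(hR i).refl (hx.nonneg i (Finset.mem_univ i)),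
    (hR i).refl (hx.nonneg i (Finset.mem_univ i))⟩

/-- Envy means `x i < x j`, so `j` is outside the tight set of `i`. An allocation that moves only
`i` and `j` and raises `i` would overfill that set. -/
theorem IsFair.isEnvyFree {x : V → ℝ} (hx : IsFair G b x)
    {R : V → ℝ → ℝ → Prop} (hR : ∀ i, IsSinglePeaked (R i) (b i)) : IsEnvyFree G b R x := by
  rintro i j ⟨hij, hij'⟩ ⟨x', hx', hx'k, hx'i, hx'i'⟩
  have hx0 : ∀ i, 0 ≤ x i := fun i => hx.nonneg i (Finset.mem_univ i)
  have hxb : ∀ i, x i ≤ b i := fun i => hx.le_supply i (Finset.mem_univ i)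
  have h1 : x i < x j := by
    refine lt_of_le_of_ne ((hR i).le_of_rel (hx0 j) (hxb i) hij) fun he => hij' ?_
    rw [← he]
    exact (hR i).refl (hx0 i)
  have h2 : x i < x' i := by
    refine lt_of_le_of_ne ((hR i).le_of_rel (hx'.nonneg i) (hxb i) hx'i) fun he => hx'i' ?_
    rw [← he]
    exact (hR i).refl (hx0 i)
  obtain ⟨T, -, hiT, hT, hTi⟩ := hx.exists_tight i (Finset.mem_univ i)
    (h2.trans_le (hx'.le_peak i))
  have hlt : ∑ k ∈ T, x k < ∑ k ∈ T, x' k := by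
    refine Finset.sum_lt_sum (fun k hk => ?_) ⟨i, hiT, h2⟩
    by_cases hki : k = i
    · exact hki ▸ h2.le
    · refine (hx'k k hki ?_).ge
      rintro rfl
      exact (hTi k hk).not_gt h1
  exact (hlt.trans_le (hx'.sum_le T)).ne hT

/-- An agent below his peak cannot change the fair point by another report of at least his share. -/
theorem IsFair.update [DecidableEq V] {x : V → ℝ} (hb : ∀ i, 0 ≤ b i) (hx : IsFair G b x)
    {i : V} (hi : x i < b i) {p : ℝ} (hp : x i ≤ p) : IsFair G (Function.update b i p) x := by
  have hfeas : IsFeasibleAllocation G (Function.update b i p) x := by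
    obtain ⟨f, hf, hfx⟩ := hx.isFeasibleAllocation hb
    refine ⟨f, ⟨hf.nonneg, hf.support, hf.symm, fun k => ?_⟩, hfx⟩
    by_cases hk : k = i
    · subst hk
      rw [hfx, Function.update_self]
      exact hp
    · rw [Function.update_of_ne hk]
      exact hf.le_peak k
  refine ⟨fun k _ => hfeas.nonneg k, fun k _ => hfeas.le_peak k, fun X _ => hfeas.sum_le X,
    fun k _ hk => ?_⟩
  have hkb : x k < b k := by
    by_cases hki : k = i
    · exact hki ▸ hi
    · simpa [doubled, Function.update_of_ne hki] using hk
  obtain ⟨T, hTS, hkT, hT, hTk⟩ := hx.exists_tight k (Finset.mem_univ k) hkb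
  refine ⟨T, hTS, hkT, ?_, hTk⟩
  rw [hT, neighbors_doubled_congr (Function.update b i p) b]
  refine Finset.sum_congr rfl fun j hj => ?_
  -- The report of `i` does not enter the demand reached by `T`, so `T` stays tight.
  have hji : j ≠ i := by
    rintro rfl
    exact hx.not_mem_neighbors hb hT hi hj
  simp [doubled, Function.update_of_ne hji]

/-- As `x i ≤ b i`, getting less is worse, and getting more is worse if `x i = b i`. If `x i < b i`,
getting more requires `p > x i`; then `x` is still fair after the report, and uniqueness excludes
the gain. -/
theorem isPeakStrategyproof_egalitarianRule [DecidableEq V] (G : SimpleGraph V) :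
    IsPeakStrategyproof (egalitarianRule G) := by
  intro b hb i Ri hRi p hp
  have hb' : ∀ k, 0 ≤ Function.update b i p k := by
    intro k
    by_cases hk : k = i
    · subst hk
      simpa using hp
    · simpa [Function.update_of_ne hk] using hb k
  have hx := isFair_egalitarianRule (G := G) hb
  have hy := isFair_egalitarianRule (G := G) hb'
  set x := egalitarianRule G b
  set y := egalitarianRule G (Function.update b i p)
  have hx0 := hx.nonneg i (Finset.mem_univ i)
  have hy0 := hy.nonneg i (Finset.mem_univ i)
  have hxb : x i ≤ b i := hx.le_supply i (Finset.mem_univ i)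
  have hyp : y i ≤ p := by
    simpa [doubled] using hy.le_supply i (Finset.mem_univ i)
  rcases lt_trichotomy (y i) (x i) with hlt | heq | hgt
  · exact (hRi.below _ _ hy0 hlt hxb).1
  · rw [heq]
    exact hRi.refl hx0
  · rcases hxb.lt_or_eq with hlt | heq
    · exact absurd ((hx.update hb hlt (hgt.le.trans hyp)).eq hy i (Finset.mem_univ i)) hgt.ne
    · exact (hRi.above _ _ hx0 heq.ge hgt).1

end Exchange

/-! ### Order statistics and Lorenz dominance -/

namespace Exchange

theorem sum_min_le_sum_take (l : List ℝ) (k : ℕ) (hk : k ≤ l.length) (t : ℝ) :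
    (l.map fun a => min a t).sum ≤ (l.take k).sum + (l.length - k) * t := by
  induction l generalizing k with
  | nil => simp_all
  | cons a l ih =>
    cases k with
    | zero =>
      have := ih 0 (Nat.zero_le _)
      have h2 := min_le_right a t
      simp at this ⊢
      linarith
    | succ k =>
      have := ih k (by simpa using hk)
      have h2 := min_le_left a t
      simp only [List.map_cons, List.sum_cons, List.take_succ_cons, List.length_cons]
      push_cast
      linarith

/-- For a sorted list the bound of `sum_min_le_sum_take` is attained. -/
theorem exists_sum_take_le_sum_min (l : List ℝ) (hl : l.Pairwise (· ≤ ·)) (k : ℕ)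
    (hk1 : 1 ≤ k) (hk : k ≤ l.length) :
    ∃ t, (l.take k).sum + (l.length - k) * t ≤ (l.map fun a => min a t).sum := by
  have hlt : k - 1 < l.length := by omega
  -- The level is the `k`-th smallest entry: the cap leaves the first `k` entries alone and flattens
  -- the others.
  refine ⟨l[k - 1], ?_⟩
  set t := l[k - 1] with ht
  have h1 : ∀ a ∈ l.take k, min a t = a := by
    intro a ha
    obtain ⟨m, hm, rfl⟩ := List.mem_iff_getElem.1 ha
    rw [List.getElem_take]
    rw [List.length_take] at hm
    exact min_eq_left (hl.sortedLE.getElem_le_getElem_of_le (by omega))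
  have h2 : ∀ a ∈ l.drop k, min a t = t := by
    intro a ha
    obtain ⟨m, hm, rfl⟩ := List.mem_iff_getElem.1 ha
    rw [List.getElem_drop]
    exact min_eq_right (hl.sortedLE.getElem_le_getElem_of_le (by omega))
  have h3 : (l.map fun a => min a t) = l.take k ++ List.replicate (l.length - k) t := by
    conv_lhs => rw [← List.take_append_drop k l]
    rw [List.map_append, List.map_congr_left h1, List.map_congr_left h2]
    simp
  rw [h3, List.sum_append, List.sum_replicate, nsmul_eq_mul, Nat.cast_sub hk]

theorem sum_map_sort_min {V : Type*} [Fintype V] (z : V → ℝ) (t : ℝ) :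
    (((Finset.univ.val.map z).sort (· ≤ ·)).map fun a => min a t).sum = ∑ i, min (z i) t := by
  rw [← Multiset.sum_coe, ← Multiset.map_coe, Multiset.sort_eq, Multiset.map_map]
  rfl

/-- For `n` agents and `1 ≤ k ≤ n`, the sum of the `k` smallest coordinates is the maximum over `t`
of `∑ min (z i) t - (n - k) * t`, hence monotone in the capped sums. -/
theorem lorenzDominates_of_sum_min_le {V : Type*} [Fintype V] {x w : V → ℝ}
    (h : ∀ t, ∑ i, min (w i) t ≤ ∑ i, min (x i) t) : LorenzDominates x w := by
  intro k hk1 hk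
  have hlen : ∀ z : V → ℝ, ((Finset.univ.val.map z).sort (· ≤ ·)).length = Fintype.card V := by
    intro z
    simp
  obtain ⟨t, ht⟩ := exists_sum_take_le_sum_min ((Finset.univ.val.map w).sort (· ≤ ·))
    (Multiset.pairwise_sort _ _) k hk1 (hk.trans (hlen w).ge)
  have hx := sum_min_le_sum_take ((Finset.univ.val.map x).sort (· ≤ ·)) k
    (hk.trans (hlen x).ge) t
  rw [sum_map_sort_min, hlen] at ht hx
  have := h t
  simp only [lowestSum]
  linarith

theorem IsFair.lorenzDominates {V : Type*} [Fintype V] {G : SimpleGraph V} {b x w : V → ℝ}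
    (hb : ∀ i, 0 ≤ b i) (hx : IsFair G b x) (hw : IsFeasibleAllocation G b w) :
    LorenzDominates x w :=
  lorenzDominates_of_sum_min_le fun t => BipartiteNetwork.IsEgalitarian.sum_min_le hb hx
    (fun i _ => hw.le_peak i) (fun X _ => hw.sum_le X) t

end Exchange

theorem mainTheorem5 {V : Type*} [Fintype V] [DecidableEq V] (G : SimpleGraph V) :
    (∀ b : V → ℝ, (∀ i, 0 ≤ b i) →
      -- feasible flows on the doubled network give feasible exchanges on `G`
      (∀ φ, (Exchange.doubled G b).IsFeasibleFlow φ →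
        Exchange.IsFeasibleExchange G b (Exchange.symmetrize φ) ∧
        ∀ i, Exchange.allocation (Exchange.symmetrize φ) i = (φ.src i + φ.snk i) / 2) ∧
      -- and vice versa
      (∀ f, Exchange.IsFeasibleExchange G b f →
        (Exchange.doubled G b).IsFeasibleFlow (Exchange.toFlow f)) ∧
      -- the egalitarian allocation is realized by a feasible flow on the doubled network
      (∃ φ, (Exchange.doubled G b).IsFeasibleFlow φ ∧
        φ.src = (Exchange.doubled G b).egalitarianSupply ∧
        φ.snk = (Exchange.doubled G b).egalitarianDemand) ∧
      -- and each such flow gives a feasible exchange on `G` that induces the egalitarian rule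
      (∀ φ, (Exchange.doubled G b).IsFeasibleFlow φ →
        φ.src = (Exchange.doubled G b).egalitarianSupply →
        φ.snk = (Exchange.doubled G b).egalitarianDemand →
        Exchange.IsFeasibleExchange G b (Exchange.symmetrize φ) ∧
        Exchange.allocation (Exchange.symmetrize φ) = Exchange.egalitarianRule G b) ∧
      -- for every profile of single-peaked preferences with these peaks
      ∀ R : V → ℝ → ℝ → Prop, (∀ i, Exchange.IsSinglePeaked (R i) (b i)) →
        Exchange.IsParetoOptimal G b R (Exchange.egalitarianRule G b) ∧
        Exchange.IsLorenzDominant G b R (Exchange.egalitarianRule G b) ∧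
        Exchange.IsEnvyFree G b R (Exchange.egalitarianRule G b)) ∧
    Exchange.IsPeakStrategyproof (Exchange.egalitarianRule G) := by
  refine ⟨fun b hb => ?_, Exchange.isPeakStrategyproof_egalitarianRule G⟩
  have hx := Exchange.isFair_egalitarianRule (G := G) hb
  refine ⟨fun φ hφ => ⟨Exchange.isFeasibleExchange_symmetrize hφ,
    Exchange.allocation_symmetrize hφ⟩, fun f hf => Exchange.isFeasibleFlow_toFlow hf, ?_,
    fun φ hφ h1 h2 => ⟨Exchange.isFeasibleExchange_symmetrize hφ, ?_⟩, fun R hR =>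
    ⟨hx.isParetoOptimal hb hR, ⟨hx.isParetoOptimal hb hR, fun w hw => ?_⟩, hx.isEnvyFree hR⟩⟩
  · rw [Exchange.egalitarianDemand_doubled, ← Exchange.egalitarianRule_eq]
    exact Exchange.IsFair.exists_flow hb hx
  · ext i
    rw [Exchange.allocation_symmetrize hφ, h1, h2, Exchange.egalitarianRule]
  · exact Exchange.IsFair.lorenzDominates hb hx hw.1
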